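/- A \emph{conjunctive regular path query} (CRPQ) $Q$ is a finite, nonempty conjunction of atoms $R(X,Y)$, where $R$ is a regular expression over an alphabet and $X,Y$ are variables, together with a set $\mathsf{free}(Q)\subseteq\mathsf{vars}(Q)$ of \emph{free} variables; the other variables are \emph{bound}. $Q$ is \emph{acyclic} if the multigraph on $\mathsf{vars}(Q)$ with one edge $\{X,Y\}$ for each atom $R(X,Y)$ is a forest (in particular without self-loops and parallel edges). For $S\subseteq\mathsf{vars}(Q)$, let $\rho^*_Q(S)$ be the minimum of $\sum_a w_a$ over all assignments of weights $w_a\ge 0$ to the atoms $a$ of $Q$ such that $\sum_{a\ni X} w_a\ge 1$ for every $X\in S$. A \emph{tree decomposition} of $Q$ is a finite tree $T$ with bags $\chi(t)\subseteq\mathsf{vars}(Q)$, $t\in\mathsf{nodes}(T)$, such that the variables of each atom are contained in some bag and, for each variable $X$, the nodes $t$ with $X\in\chi(t)$ induce a nonempty connected subtree. It is \emph{free-connex} if there is a (possibly empty) connected subtree of $T$ the union of whose bags is exactly $\mathsf{free}(Q)$. Define $$\textsf{fn-fhtw}(Q)=\min_{(T,\chi)\text{ free-connex}}\ \max_{t\in\mathsf{nodes}(T)}\rho^*_Q(\chi(t)).$$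 The \emph{bound-connected components} $Q_1,\dots,Q_m$ of $Q$ correspond to the classes of the finest equivalence relation on the atoms of $Q$ under which any two atoms that share a bound variable are equivalent: $Q_i$ is the conjunction of the atoms in the $i$-th class, with $\mathsf{free}(Q_i)=\mathsf{free}(Q)\cap\mathsf{vars}(Q_i)$. \textbf{Lemma.} For every acyclic CRPQ $Q$ with bound-connected components $Q_1,\dots,Q_m$, $$\textsf{fn-fhtw}(Q)=\max\Bigl(1,\ \max_{i\in[m]}\rho^*_{Q_i}(\mathsf{free}(Q_i))\Bigr).$$ -/

import Mathlib

open scoped ENNReal NNReal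

/-- An atom `R(X, Y)`: a regular expression `R` over the alphabet `A` and two variables. -/
structure RPQAtom (A V : Type*) where
  expr : RegularExpression A
  src : V
  tgt : V

/-- The variables of an atom. -/
def RPQAtom.vars {A V : Type*} (a : RPQAtom A V) : Set V := {a.src, a.tgt}

/-- A conjunctive regular path query: a finite conjunction of atoms, together with a set of
free variables, all of which occur in the atoms. -/
structure CRPQ (A V : Type*) where
  atoms : Finset (RPQAtom A V)
  free : Set V
  free_subset : ∀ X ∈ free, ∃ a ∈ atoms, X ∈ a.vars

namespace CRPQ

/-- The variables of the query. -/
def vars {A V : Type*} (Q : CRPQ A V) : Set V := {X | ∃ a ∈ Q.atoms, X ∈ a.vars}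

/-- The underlying simple graph of the query graph: distinct variables are adjacent iff some
atom contains both. (Values of `V` that do not occur in the query are isolated vertices.) -/
def queryGraph {A V : Type*} (Q : CRPQ A V) : SimpleGraph V :=
  SimpleGraph.fromRel fun X Y => ∃ a ∈ Q.atoms, a.src = X ∧ a.tgt = Y

/-- A CRPQ is acyclic if its query (multi)graph is a forest: it has no self-loops, no parallel
edges (in either orientation), and no cycles. -/
structure IsAcyclic {A V : Type*} (Q : CRPQ A V) : Prop where
  no_loops : ∀ a ∈ Q.atoms, a.src ≠ a.tgt
  no_parallel : ∀ a ∈ Q.atoms, ∀ b ∈ Q.atoms, s(a.src, a.tgt) = s(b.src, b.tgt) → a = b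
  acyclic : Q.queryGraph.IsAcyclic

open Classical in
/-- `w` is a fractional edge cover of the set `S` of variables by the atoms of `Q`. -/
def IsFractionalCover {A V : Type*} (Q : CRPQ A V) (S : Set V) (w : RPQAtom A V → ℝ≥0) : Prop :=
  ∀ X ∈ S, 1 ≤ ∑ a ∈ Q.atoms with X ∈ a.vars, w a

/-- The fractional edge cover number `ρ*_Q(S)`: the least total weight of a fractional edge
cover of `S` by the atoms of `Q` (it is `∞` iff `S` is not contained in `Q.vars`). -/
noncomputable def rhoStar {A V : Type*} (Q : CRPQ A V) (S : Set V) : ℝ≥0∞ :=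
  ⨅ (w : RPQAtom A V → ℝ≥0) (_ : Q.IsFractionalCover S w), ((∑ a ∈ Q.atoms, w a : ℝ≥0) : ℝ≥0∞)

/-- A tree decomposition of `Q`: a finite tree with a bag of variables at every node, such that
the variables of every atom lie together in some bag, and the nodes whose bags contain a given
variable are connected in the tree. -/
structure TreeDecomposition {A V : Type*} (Q : CRPQ A V) where
  node : Type
  finite_node : Finite node
  tree : SimpleGraph node
  isTree : tree.IsTree
  bag : node → Set V
  bag_subset : ∀ t, bag t ⊆ Q.vars
  covers : ∀ a ∈ Q.atoms, ∃ t, a.vars ⊆ bag t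
  connected : ∀ X ∈ Q.vars, (tree.induce {t | X ∈ bag t}).Connected

/-- A tree decomposition is free-connex if it has a (possibly empty) connected subtree such that
the union of the bags of this subtree is exactly the set of free variables. -/
def TreeDecomposition.IsFreeConnex {A V : Type*} {Q : CRPQ A V} (D : Q.TreeDecomposition) : Prop :=
  ∃ N : Set D.node, (D.tree.induce N).Preconnected ∧ ⋃ t ∈ N, D.bag t = Q.free

/-- The fractional width of a tree decomposition: the maximum of `ρ*_Q` over its bags. -/
noncomputable def TreeDecomposition.width {A V : Type*} {Q : CRPQ A V}
    (D : Q.TreeDecomposition) : ℝ≥0∞ :=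
  ⨆ t, Q.rhoStar (D.bag t)

/-- The free-connex fractional hypertree width of `Q`: the least width of a free-connex tree
decomposition of `Q`. -/
noncomputable def fnFhtw {A V : Type*} (Q : CRPQ A V) : ℝ≥0∞ :=
  ⨅ (D : Q.TreeDecomposition) (_ : D.IsFreeConnex), D.width

/-- Two atoms of `Q` share a bound (that is, non-free) variable. -/
def SharesBound {A V : Type*} (Q : CRPQ A V) (a b : RPQAtom A V) : Prop :=
  a ∈ Q.atoms ∧ b ∈ Q.atoms ∧ ∃ X, X ∉ Q.free ∧ X ∈ a.vars ∧ X ∈ b.vars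

open Classical in
/-- The bound-connected component of `Q` that contains the atom `a`: its atoms are those that can
be reached from `a` by a chain of atoms of `Q`, consecutive ones sharing a bound variable; its
free variables are the free variables of `Q` that occur in these atoms. -/
noncomputable def boundComponent {A V : Type*} (Q : CRPQ A V) (a : RPQAtom A V) : CRPQ A V where
  atoms := Q.atoms.filter fun b => Relation.ReflTransGen Q.SharesBound a b
  free := {X ∈ Q.free | ∃ b ∈ Q.atoms.filter fun b => Relation.ReflTransGen Q.SharesBound a b,
    X ∈ b.vars}
  free_subset := fun _ hX => hX.2

/-- The (finite) set of bound-connected components `Q₁, …, Qₘ` of `Q`. -/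
def boundComponents {A V : Type*} (Q : CRPQ A V) : Set (CRPQ A V) :=
  {C | ∃ a ∈ Q.atoms, C = Q.boundComponent a}

end CRPQ

/-!
Write `ρ_C` for the number `ρ*_C(free C)` of a bound-connected component `C`. A component without
bound variables is a single atom and has `ρ_C ≤ 1`. If `C` has a bound variable, then each of its
atoms has one, hence at most one free variable.

*Lower bound.* Let `C` have a bound variable, and take a free-connex tree decomposition with free
part `N`. The nodes whose bags contain a bound variable of `C` form a subtree disjoint from `N`, and
each free variable of `C` occurs in bags of both. So the node of `N` nearest to that subtree
contains all of `free C` (`SimpleGraph.IsTree.exists_gate`,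
`TreeDecomposition.IsFreeConnex.exists_free_subset_bag`). No atom of `Q` contains two elements of
`free C`, as that would close a cycle (`IsAcyclic.eq_of_mem_boundComponent_free`), so covering this
bag costs at least `|free C|`, and `ρ_C ≤ |free C|`.

*Upper bound.* Root every tree of the query graph, at a free variable if it has one
(`SimpleGraph.IsAcyclic.exists_parent`). Let `below u` be the set of free variables from which `u`
is reached by climbing through bound variables. The bags `{u, par u} ∪ below u`, each attached to
the bag of `par u` if `par u` is bound, decompose the part below each free variable. Their free
parts, attached to one another along the whole forest, form the connected subtree that witnesses
free-connexity, and carry the remaining bags. If `u` is bound and `below u` is nonempty, then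
`below u`, together with the first free variable above `u`, consists of `|below u| + 1` free
variables of one component. No atom of the component contains two of them, so
`|below u| + 1 ≤ ρ_C`, and the bag of `u` is covered by the edge from `u` to its parent and one
atom for each element of `below u` (`Rooting.rhoStar_bag_le`).
-/

/-! ### Trees: connected subtrees and parent functions -/

namespace SimpleGraph

theorem Reachable.deleteEdges_of_induce {ι : Type*} {G : SimpleGraph ι} {S : Set ι} {a b : S}
    (h : (G.induce S).Reachable a b) {v w : ι} (hvw : v ∉ S ∨ w ∉ S) :
    (G.deleteEdges {s(v, w)}).Reachable a b := by
  refine h.map (⟨Subtype.val, ?_⟩ : G.induce S →g G.deleteEdges {s(v, w)})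
  rintro ⟨x, hx⟩ ⟨y, hy⟩ hxy
  rw [deleteEdges_adj]
  refine ⟨hxy, fun h => ?_⟩
  rw [Set.mem_singleton_iff, Sym2.eq_iff] at h
  grind

/-- A walk that starts outside `N` and ends in `N` has a first edge entering `N`. -/
theorem Walk.exists_adj_entering {ι : Type*} {G : SimpleGraph ι} {N : Set ι} {u v : ι}
    (p : G.Walk u v) (hu : u ∉ N) (hv : v ∈ N) :
    ∃ s t, ∃ hs : s ∈ Nᶜ, t ∈ N ∧ G.Adj s t ∧
      (G.induce Nᶜ).Reachable ⟨u, hu⟩ ⟨s, hs⟩ := by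
  induction p with
  | nil => exact absurd hv hu
  | @cons u w v h p ih =>
    by_cases hw : w ∈ N
    · exact ⟨u, w, hu, hw, h, .rfl⟩
    · obtain ⟨s, t, hs, ht, hst, hr⟩ := ih hw hv
      have huw : (G.induce Nᶜ).Adj ⟨u, hu⟩ ⟨w, hw⟩ := h
      exact ⟨s, t, hs, ht, hst, huw.reachable.trans hr⟩

/-- Two disjoint subtrees `M` and `N` of a tree have a gate: a node of `N` that belongs to every
subtree meeting both of them. -/
theorem IsTree.exists_gate {ι : Type*} {T : SimpleGraph ι} (hT : T.IsTree) {M N : Set ι}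
    (hM : (T.induce M).Preconnected) (hN : (T.induce N).Preconnected) (hMN : Disjoint M N)
    (hM' : M.Nonempty) (hN' : N.Nonempty) :
    ∃ t ∈ N, ∀ S : Set ι, (T.induce S).Preconnected → (S ∩ M).Nonempty → (S ∩ N).Nonempty →
      t ∈ S := by
  obtain ⟨m, hm⟩ := hM'
  obtain ⟨n, hn⟩ := hN'
  have hd := Set.disjoint_left.1 hMN
  obtain ⟨p⟩ := hT.connected m n
  obtain ⟨s, t, hs, ht, hst, hr⟩ := p.exists_adj_entering (hd hm) hn
  refine ⟨t, ht, fun S hS => ?_⟩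
  rintro ⟨a, haS, haM⟩ ⟨b, hbS, hbN⟩
  by_contra htS
  -- The edge entering `N` at `t` is a bridge, but `s`, `m`, `a`, `b`, `t` are linked without it.
  have hbr := isAcyclic_iff_forall_adj_isBridge.1 hT.isAcyclic hst
  rw [isBridge_iff] at hbr
  apply hbr
  have h1 := (hr.symm).deleteEdges_of_induce (v := s) (w := t) (Or.inr (fun h => h ht))
  have h2 := (hM ⟨m, hm⟩ ⟨a, haM⟩).deleteEdges_of_induce (v := s) (w := t)
    (Or.inr fun h => hd h ht)
  have h3 := (hS ⟨a, haS⟩ ⟨b, hbS⟩).deleteEdges_of_induce (v := s) (w := t) (Or.inr htS)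
  have h4 := (hN ⟨b, hbN⟩ ⟨t, ht⟩).deleteEdges_of_induce (v := s) (w := t) (Or.inl hs)
  exact h1.trans (h2.trans (h3.trans h4))

/-- The graph joining every element to its parent. A root is its own parent. -/
def ofParent {ι : Type*} (par : ι → ι) : SimpleGraph ι :=
  fromRel fun i j => par i = j

theorem ofParent_adj_parent {ι : Type*} {par : ι → ι} {i : ι} (h : par i ≠ i) :
    (ofParent par).Adj i (par i) := by
  simp [ofParent, fromRel_adj, h.symm]

/-- If parents have smaller rank, the parent graph has no cycle: deleting the edge from `i` to its
parent separates the descendants of `i` from all other elements. -/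
theorem ofParent_isAcyclic {ι : Type*} {par : ι → ι} (rank : ι → ℕ)
    (hrank : ∀ i, par i ≠ i → rank (par i) < rank i) : (ofParent par).IsAcyclic := by
  have key : ∀ i, par i ≠ i → (ofParent par).IsBridge s(i, par i) := by
    intro i hi
    rw [isBridge_iff]
    intro hr
    have hdesc : ∀ x, Relation.ReflTransGen
        ((ofParent par).deleteEdges {s(i, par i)}).Adj i x →
        Relation.ReflTransGen (fun a b => par a = b) x i := by
      intro x hx
      induction hx with
      | refl => exact .refl
      | @tail b c _ hbc ih =>
        rw [deleteEdges_adj, ofParent, fromRel_adj] at hbc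
        obtain ⟨⟨hne, h | h⟩, hdel⟩ := hbc
        · rcases Relation.ReflTransGen.cases_head ih with rfl | ⟨d, hd, hdi⟩
          · exact absurd (by simp [h]) hdel
          · rwa [← h, hd]
        · exact .head h ih
    have hle : ∀ x, Relation.ReflTransGen (fun a b => par a = b) x i → rank i ≤ rank x := by
      intro x hx
      induction hx using Relation.ReflTransGen.head_induction_on with
      | refl => exact le_rfl
      | @head a c h _ ih =>
        by_cases hac : par a = a
        · rw [← h, hac] at ih
          exact ih
        · have := hrank a hac
          rw [h] at this
          omega
    have := hle _ (hdesc _ ((reachable_iff_reflTransGen _ _).1 hr))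
    have := hrank i hi
    omega
  rw [isAcyclic_iff_forall_adj_isBridge]
  intro v w hvw
  rw [ofParent, fromRel_adj] at hvw
  obtain ⟨hne, rfl | rfl⟩ := hvw
  · exact key v hne.symm
  · rw [Sym2.eq_swap]
    exact key w hne

/-- A set of elements that is closed under parents, except at a single member `m`, induces a
connected subgraph of the parent graph. -/
theorem ofParent_induce_connected {ι : Type*} {par : ι → ι} (rank : ι → ℕ)
    (hrank : ∀ i, par i ≠ i → rank (par i) < rank i) {S : Set ι} {m : ι} (hm : m ∈ S)
    (hS : ∀ i ∈ S, i ≠ m → par i ≠ i ∧ par i ∈ S) : ((ofParent par).induce S).Connected := by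
  rw [connected_iff_exists_forall_reachable]
  refine ⟨⟨m, hm⟩, ?_⟩
  rintro ⟨i, hi⟩
  induction hk : rank i using Nat.strong_induction_on generalizing i with
  | _ k ih =>
    by_cases him : i = m
    · subst him
      exact .rfl
    · obtain ⟨h1, h2⟩ := hS i hi him
      have := hrank i h1
      have hadj : ((ofParent par).induce S).Adj ⟨i, hi⟩ ⟨par i, h2⟩ := ofParent_adj_parent h1
      exact (ih _ (by omega) _ h2 rfl).trans hadj.symm.reachable

/-- A forest can be rooted: there is a parent function whose edges are exactly the edges of the
forest, and every tree that meets `F` has its root in `F`. -/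
theorem IsAcyclic.exists_parent {V : Type*} {G : SimpleGraph V} (hG : G.IsAcyclic) (F : Set V) :
    ∃ (p : V → V) (depth : V → ℕ), (∀ x, p x ≠ x → G.Adj x (p x) ∧ depth (p x) < depth x) ∧
      (∀ u v, G.Adj u v → p u = v ∨ p v = u) ∧
      ∀ x, p x = x → x ∉ F → ∀ y, G.Reachable y x → y ∉ F := by
  classical
  have hroot : ∀ c : G.ConnectedComponent, ∃ r, G.connectedComponentMk r = c ∧
      (r ∉ F → ∀ y, G.connectedComponentMk y = c → y ∉ F) := by
    intro c
    by_cases h : ∃ y, G.connectedComponentMk y = c ∧ y ∈ F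
    · obtain ⟨y, hy, hF⟩ := h
      exact ⟨y, hy, fun h => absurd hF h⟩
    · obtain ⟨r, hr⟩ := c.exists_rep
      exact ⟨r, hr, fun _ y hy hF => h ⟨y, hy, hF⟩⟩
  choose root hroot₁ hroot₂ using hroot
  set r : V → V := fun x => root (G.connectedComponentMk x) with hr
  have hreach : ∀ x, G.Reachable x (r x) := fun x =>
    (ConnectedComponent.exact (hroot₁ (G.connectedComponentMk x))).symm
  have hradj : ∀ x y, G.Adj x y → r x = r y := fun x y h => by
    simp only [hr, ConnectedComponent.sound h.reachable]
  have hcloser : ∀ x z, G.Reachable x z → x ≠ z → ∃ y, G.Adj x y ∧ G.dist y z < G.dist x z := by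
    intro x z hxz hne
    obtain ⟨w, hw⟩ := hxz.exists_walk_length_eq_dist
    cases w with
    | nil => exact absurd rfl hne
    | @cons _ y _ h q =>
      refine ⟨y, h, ?_⟩
      have := dist_le q
      rw [Walk.length_cons] at hw
      omega
  have hnext : ∀ x, x ≠ r x → ∃ y, G.Adj x y ∧ G.dist y (r x) < G.dist x (r x) :=
    fun x => hcloser x (r x) (hreach x)
  choose! p hp using hnext
  let q : V → V := fun x => if x = r x then x else p x
  have hq : ∀ x, q x ≠ x → x ≠ r x ∧ q x = p x := by
    intro x hx
    by_cases h : x = r x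
    · exact absurd (if_pos h) hx
    · exact ⟨h, if_neg h⟩
  have hq' : ∀ x, x ≠ r x → q x = p x := fun x h => if_neg h
  have hqp : ∀ x, q x ≠ x → G.Adj x (q x) ∧ G.dist (q x) (r (q x)) < G.dist x (r x) := by
    intro x hx
    obtain ⟨h1, h2⟩ := hq x hx
    obtain ⟨h3, h4⟩ := hp x h1
    rw [h2, ← hradj _ _ h3]
    exact ⟨h3, h4⟩
  refine ⟨q, fun x => G.dist x (r x), hqp, ?_, ?_⟩
  · intro u v huv
    by_contra! hcon
    -- Otherwise the parent edges alone link `u` and `v` to their common root.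
    have hbr := isAcyclic_iff_forall_adj_isBridge.1 hG huv
    rw [isBridge_iff] at hbr
    have hto : ∀ x, (G.deleteEdges {s(u, v)}).Reachable x (r x) := by
      intro x
      induction hk : G.dist x (r x) using Nat.strong_induction_on generalizing x with
      | _ k ih =>
        by_cases hx : x = r x
        · exact hx ▸ .rfl
        · have hne : q x ≠ x := by
            rw [hq' x hx]
            exact (hp x hx).1.ne'
          obtain ⟨h1, h2⟩ := hqp x hne
          have h3 : (G.deleteEdges {s(u, v)}).Adj x (q x) := by
            rw [deleteEdges_adj]
            refine ⟨h1, fun h => ?_⟩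
            rw [Set.mem_singleton_iff, Sym2.eq_iff] at h
            rcases h with ⟨rfl, h⟩ | ⟨rfl, h⟩
            · exact hcon.1 h
            · exact hcon.2 h
          rw [hradj _ _ h1]
          exact h3.reachable.trans (ih _ (by omega) _ rfl)
    have hu := hto u
    rw [hradj _ _ huv] at hu
    exact hbr (hu.trans (hto v).symm)
  · intro x hx hxF y hy
    have hxr : x = r x := by
      by_contra h
      exact (hp x h).1.ne' ((hq' x h).symm.trans hx)
    rw [hxr] at hxF
    exact hroot₂ _ hxF y (ConnectedComponent.sound hy)

end SimpleGraph

/-! ### Fractional edge covers -/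

namespace CRPQ

variable {A V : Type*}

theorem _root_.RPQAtom.mem_vars {a : RPQAtom A V} {X : V} :
    X ∈ a.vars ↔ X = a.src ∨ X = a.tgt := Iff.rfl

theorem vars_finite (Q : CRPQ A V) : Q.vars.Finite := by
  have h : Q.vars = ⋃ a ∈ Q.atoms, a.vars := by
    ext X
    simp [vars]
  rw [h]
  exact Q.atoms.finite_toSet.biUnion fun a _ => Set.toFinite {a.src, a.tgt}

theorem free_subset_vars (Q : CRPQ A V) : Q.free ⊆ Q.vars := Q.free_subset

theorem free_finite (Q : CRPQ A V) : Q.free.Finite := Q.vars_finite.subset Q.free_subset_vars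

/-- If no atom contains two elements of `S`, then every fractional cover of `S` spends weight at
least `1` on each element of `S` separately. -/
theorem card_le_rhoStar (Q : CRPQ A V) (S : Finset V) {T : Set V} (hST : ↑S ⊆ T)
    (hS : ∀ a ∈ Q.atoms, ∀ X ∈ S, ∀ Y ∈ S, X ∈ a.vars → Y ∈ a.vars → X = Y) :
    (S.card : ℝ≥0∞) ≤ Q.rhoStar T := by
  classical
  refine le_iInf₂ fun w hw => ?_
  have h : (S.card : ℝ≥0) ≤ ∑ a ∈ Q.atoms, w a := by
    calc (S.card : ℝ≥0) = ∑ X ∈ S, 1 := by simp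
      _ ≤ ∑ X ∈ S, ∑ a ∈ Q.atoms with X ∈ a.vars, w a := by
          refine Finset.sum_le_sum fun X hX => ?_
          convert hw X (hST hX)
      _ = ∑ a ∈ Q.atoms, ∑ X ∈ S with X ∈ a.vars, w a := by
          simp only [Finset.sum_filter]
          exact Finset.sum_comm
      _ ≤ ∑ a ∈ Q.atoms, w a := by
          refine Finset.sum_le_sum fun a ha => ?_
          have hcard : (S.filter fun X => X ∈ a.vars).card ≤ 1 := by
            refine Finset.card_le_one.2 fun X hX Y hY => ?_
            rw [Finset.mem_filter] at hX hY
            exact hS a ha X hX.1 Y hY.1 hX.2 hY.2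
          rw [Finset.sum_const, nsmul_eq_mul]
          exact mul_le_of_le_one_left zero_le (by exact_mod_cast hcard)
  exact_mod_cast h

theorem one_le_rhoStar (Q : CRPQ A V) {S : Set V} (hS : S.Nonempty) : 1 ≤ Q.rhoStar S := by
  obtain ⟨X, hX⟩ := hS
  simpa using Q.card_le_rhoStar {X} (T := S) (by simpa using hX) (by simp)

theorem rhoStar_le_card (Q : CRPQ A V) {S : Set V} (E : Finset (RPQAtom A V))
    (hE : E ⊆ Q.atoms) (hS : ∀ X ∈ S, ∃ a ∈ E, X ∈ a.vars) : Q.rhoStar S ≤ E.card := by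
  classical
  refine iInf₂_le_of_le (fun a => if a ∈ E then 1 else 0) ?_ ?_
  · intro X hX
    obtain ⟨a, ha, hXa⟩ := hS X hX
    have hmem : a ∈ Q.atoms.filter fun b => X ∈ b.vars := Finset.mem_filter.2 ⟨hE ha, hXa⟩
    have h := Finset.single_le_sum
      (f := fun a => if a ∈ E then (1 : ℝ≥0) else 0) (fun _ _ => zero_le) hmem
    rw [if_pos ha] at h
    convert h
  · rw [← Finset.sum_filter, Finset.filter_mem_eq_inter, Finset.inter_eq_right.2 hE]
    simp

theorem exists_atoms_covering (Q : CRPQ A V) (L : Finset V) (hL : ↑L ⊆ Q.vars) :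
    ∃ E ⊆ Q.atoms, E.card ≤ L.card ∧ ∀ X ∈ L, ∃ a ∈ E, X ∈ a.vars := by
  classical
  have hex : ∀ X : L, ∃ b ∈ Q.atoms, X.1 ∈ b.vars := fun X => hL X.2
  choose e he using hex
  refine ⟨L.attach.image e, ?_, ?_, ?_⟩
  · intro b hb
    obtain ⟨X, _, rfl⟩ := Finset.mem_image.1 hb
    exact (he X).1
  · exact Finset.card_image_le.trans L.card_attach.le
  · exact fun X h => ⟨e ⟨X, h⟩, Finset.mem_image_of_mem _ (Finset.mem_attach _ _), (he ⟨X, h⟩).2⟩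

theorem rhoStar_le_one_add_card (Q : CRPQ A V) {S : Set V} {a : RPQAtom A V} (ha : a ∈ Q.atoms)
    (L : Finset V) (hL : ↑L ⊆ Q.vars) (hS : S ⊆ a.vars ∪ L) :
    Q.rhoStar S ≤ ((L.card + 1 : ℕ) : ℝ≥0∞) := by
  classical
  obtain ⟨E, hE, hcard, hcov⟩ := Q.exists_atoms_covering L hL
  refine (Q.rhoStar_le_card (insert a E) (Finset.insert_subset ha hE) ?_).trans ?_
  · intro X hX
    rcases hS hX with h | h
    · exact ⟨a, Finset.mem_insert_self _ _, h⟩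
    · obtain ⟨b, hb, hXb⟩ := hcov X h
      exact ⟨b, Finset.mem_insert_of_mem hb, hXb⟩
  · exact_mod_cast (Finset.card_insert_le _ _).trans (Nat.add_le_add_right hcard 1)

theorem rhoStar_le_card_self (Q : CRPQ A V) (L : Finset V) (hL : ↑L ⊆ Q.vars) :
    Q.rhoStar ↑L ≤ (L.card : ℝ≥0∞) := by
  obtain ⟨E, hE, hcard, hcov⟩ := Q.exists_atoms_covering L hL
  exact (Q.rhoStar_le_card E hE hcov).trans (by exact_mod_cast hcard)

theorem rhoStar_le_one (Q : CRPQ A V) {S : Set V} {a : RPQAtom A V} (ha : a ∈ Q.atoms)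
    (hS : S ⊆ a.vars) : Q.rhoStar S ≤ 1 := by
  simpa using Q.rhoStar_le_one_add_card ha ∅ (by simp) (hS.trans Set.subset_union_left)

/-! ### Bound-connected components -/

theorem queryGraph_adj {Q : CRPQ A V} {u v : V} :
    Q.queryGraph.Adj u v ↔ u ≠ v ∧ ∃ a ∈ Q.atoms, u ∈ a.vars ∧ v ∈ a.vars := by
  simp only [queryGraph, SimpleGraph.fromRel_adj, RPQAtom.mem_vars]
  grind

theorem mem_boundComponent_atoms {Q : CRPQ A V} {a b : RPQAtom A V} :
    b ∈ (Q.boundComponent a).atoms ↔ b ∈ Q.atoms ∧ Relation.ReflTransGen Q.SharesBound a b := by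
  simp [boundComponent]

theorem mem_boundComponent_free {Q : CRPQ A V} {a : RPQAtom A V} {X : V} :
    X ∈ (Q.boundComponent a).free ↔ X ∈ Q.free ∧
      ∃ b ∈ Q.atoms, Relation.ReflTransGen Q.SharesBound a b ∧ X ∈ b.vars := by
  simp [boundComponent, and_assoc]

theorem SharesBound.symm {Q : CRPQ A V} {a b : RPQAtom A V} (h : Q.SharesBound a b) :
    Q.SharesBound b a := by
  obtain ⟨ha, hb, X, hX, hXa, hXb⟩ := h
  exact ⟨hb, ha, X, hX, hXb, hXa⟩

theorem mem_atoms_of_reflTransGen {Q : CRPQ A V} {a b : RPQAtom A V} (ha : a ∈ Q.atoms)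
    (h : Relation.ReflTransGen Q.SharesBound a b) : b ∈ Q.atoms := by
  rcases Relation.ReflTransGen.cases_tail h with rfl | ⟨c, _, hc⟩
  · exact ha
  · exact hc.2.1

theorem exists_bound_of_reflTransGen {Q : CRPQ A V} {a b : RPQAtom A V}
    (ha : ∃ Z, Z ∉ Q.free ∧ Z ∈ a.vars) (h : Relation.ReflTransGen Q.SharesBound a b) :
    ∃ Z, Z ∉ Q.free ∧ Z ∈ b.vars := by
  rcases Relation.ReflTransGen.cases_tail h with rfl | ⟨c, _, _, _, Z, hZ, _, hZb⟩
  · exact ha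
  · exact ⟨Z, hZ, hZb⟩

theorem eq_of_reflTransGen_of_subset_free {Q : CRPQ A V} {a b : RPQAtom A V}
    (ha : a.vars ⊆ Q.free) (h : Relation.ReflTransGen Q.SharesBound a b) : b = a := by
  rcases Relation.ReflTransGen.cases_head h with rfl | ⟨c, ⟨_, _, Z, hZ, hZa, _⟩, _⟩
  · rfl
  · exact absurd (ha hZa) hZ

/-- An atom with a bound variable has room for at most one free variable. -/
theorem eq_of_mem_free_of_exists_bound {Q : CRPQ A V} {b : RPQAtom A V}
    (hb : ∃ Z, Z ∉ Q.free ∧ Z ∈ b.vars) {X Y : V} (hX : X ∈ Q.free) (hY : Y ∈ Q.free)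
    (hXb : X ∈ b.vars) (hYb : Y ∈ b.vars) : X = Y := by
  obtain ⟨Z, hZ, hZb⟩ := hb
  rw [RPQAtom.mem_vars] at *
  grind

/-- In an acyclic query, two distinct free variables of a component with bound variables never
share an atom: the component links them through bound variables, so an edge between them would
close a cycle. -/
theorem IsAcyclic.eq_of_mem_boundComponent_free {Q : CRPQ A V} (hQ : Q.IsAcyclic)
    {a : RPQAtom A V} (ha : ∃ Z, Z ∉ Q.free ∧ Z ∈ a.vars) {X Y : V}
    (hX : X ∈ (Q.boundComponent a).free) (hY : Y ∈ (Q.boundComponent a).free)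
    {d : RPQAtom A V} (hd : d ∈ Q.atoms) (hXd : X ∈ d.vars) (hYd : Y ∈ d.vars) : X = Y := by
  by_contra hne
  have hbr := SimpleGraph.isAcyclic_iff_forall_adj_isBridge.1 hQ.acyclic
    (queryGraph_adj.2 ⟨hne, d, hd, hXd, hYd⟩)
  rw [SimpleGraph.isBridge_iff] at hbr
  obtain ⟨hXf, b, hb, hab, hXb⟩ := mem_boundComponent_free.1 hX
  obtain ⟨hYf, c, hc, hac, hYc⟩ := mem_boundComponent_free.1 hY
  set G := Q.queryGraph.deleteEdges {s(X, Y)} with hG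
  have hadj : ∀ e ∈ Q.atoms, ∀ z ∈ e.vars, ∀ Z ∈ e.vars, Z ∉ Q.free → G.Reachable z Z := by
    intro e he z hz Z hZ hZf
    by_cases hzZ : z = Z
    · exact hzZ ▸ .rfl
    · refine SimpleGraph.Adj.reachable ?_
      rw [hG, SimpleGraph.deleteEdges_adj]
      refine ⟨queryGraph_adj.2 ⟨hzZ, e, he, hz, hZ⟩, fun h => ?_⟩
      rw [Set.mem_singleton_iff, Sym2.eq_iff] at h
      grind
  obtain ⟨Z₀, hZ₀f, hZ₀⟩ := ha
  have haux : ∀ e, Relation.ReflTransGen Q.SharesBound a e → e ∈ Q.atoms →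
      ∀ z ∈ e.vars, G.Reachable z Z₀ := by
    intro e hae
    induction hae with
    | refl => exact fun he z hz => hadj a he z hz Z₀ hZ₀ hZ₀f
    | @tail e e' _ h ih =>
      obtain ⟨he, he', Z, hZ, hZe, hZe'⟩ := h
      exact fun _ z hz => (hadj e' he' z hz Z hZe' hZ).trans (ih he Z hZe)
  exact hbr ((haux b hab hb X hXb).trans (haux c hac hc Y hYc).symm)

/-! ### The lower bound -/

/-- In a free-connex tree decomposition, the free variables of a component with bound variables
share a bag: the nodes whose bags contain a bound variable of the component form a subtree that is
disjoint from the free part, and the gate between the two belongs to the subtree of every free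
variable of the component. -/
theorem TreeDecomposition.IsFreeConnex.exists_free_subset_bag {Q : CRPQ A V}
    {D : Q.TreeDecomposition} (hD : D.IsFreeConnex) {a : RPQAtom A V} (haQ : a ∈ Q.atoms)
    (ha : ∃ Z, Z ∉ Q.free ∧ Z ∈ a.vars) :
    ∃ t, (Q.boundComponent a).free ⊆ D.bag t := by
  obtain ⟨N, hN, hNfree⟩ := hD
  rcases Set.eq_empty_or_nonempty (Q.boundComponent a).free with hemp | ⟨X₀, hX₀⟩
  · exact ⟨D.isTree.connected.nonempty.some, by simp [hemp]⟩
  have hmemN : ∀ X ∈ Q.free, ∃ t ∈ N, X ∈ D.bag t := by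
    intro X hX
    rw [← hNfree] at hX
    simpa using hX
  have hNmem : ∀ t ∈ N, D.bag t ⊆ Q.free := by
    intro t ht
    rw [← hNfree]
    exact Set.subset_biUnion_of_mem ht
  have hvars : ∀ b ∈ Q.atoms, ∀ X ∈ b.vars, X ∈ Q.vars := fun b hb X hX => ⟨b, hb, hX⟩
  let M : Set D.node := {t | ∃ b, Relation.ReflTransGen Q.SharesBound a b ∧
    ∃ Z ∈ b.vars, Z ∉ Q.free ∧ Z ∈ D.bag t}
  obtain ⟨Z₀, hZ₀f, hZ₀⟩ := ha
  obtain ⟨m, hm⟩ := D.covers a haQ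
  have hmM : m ∈ M := ⟨a, .refl, Z₀, hZ₀, hZ₀f, hm hZ₀⟩
  -- The nodes of one bound variable are connected inside `M`.
  have hlink : ∀ b, Relation.ReflTransGen Q.SharesBound a b → ∀ Z ∈ b.vars, Z ∉ Q.free →
      ∀ s t (_ : Z ∈ D.bag s) (_ : Z ∈ D.bag t) (hs' : s ∈ M) (ht' : t ∈ M),
      (D.tree.induce M).Reachable ⟨s, hs'⟩ ⟨t, ht'⟩ := by
    intro b hb Z hZ hZf s t hs ht hs' ht'
    have hsub : {t | Z ∈ D.bag t} ⊆ M := fun t ht => ⟨b, hb, Z, hZ, hZf, ht⟩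
    have h := (D.connected Z (hvars b (mem_atoms_of_reflTransGen haQ hb) Z hZ)).preconnected
      ⟨s, hs⟩ ⟨t, ht⟩
    exact h.map (SimpleGraph.induceHomOfLE _ hsub).toHom
  have hreach : ∀ b, Relation.ReflTransGen Q.SharesBound a b → ∀ Z ∈ b.vars, Z ∉ Q.free →
      ∀ t (_ : Z ∈ D.bag t) (ht' : t ∈ M), (D.tree.induce M).Reachable ⟨m, hmM⟩ ⟨t, ht'⟩ := by
    intro b hb
    induction hb with
    | refl => exact fun Z hZ hZf t ht ht' => hlink a .refl Z hZ hZf m t (hm hZ) ht hmM ht'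
    | @tail b c hab hbc ih =>
      intro Z hZ hZf t ht ht'
      have hac := hab.tail hbc
      obtain ⟨_, hc, Y, hY, hYb, hYc⟩ := hbc
      obtain ⟨s, hs⟩ := D.covers c hc
      have hsM : s ∈ M := ⟨c, hac, Y, hYc, hY, hs hYc⟩
      exact (ih Y hYb hY s (hs hYc) hsM).trans (hlink c hac Z hZ hZf s t (hs hZ) ht hsM ht')
  have hMconn : (D.tree.induce M).Preconnected := by
    have h : ∀ t : M, (D.tree.induce M).Reachable ⟨m, hmM⟩ t := by
      rintro ⟨t, ht⟩
      obtain ⟨b, hb, Z, hZ, hZf, hZt⟩ := id ht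
      exact hreach b hb Z hZ hZf t hZt ht
    exact fun s t => (h s).symm.trans (h t)
  have hdisj : Disjoint M N := by
    rw [Set.disjoint_left]
    rintro t ⟨b, _, Z, _, hZf, hZt⟩ ht
    exact hZf (hNmem t ht hZt)
  obtain ⟨n, hn, _⟩ := hmemN X₀ hX₀.1
  obtain ⟨t, _, ht⟩ := D.isTree.exists_gate hMconn hN hdisj ⟨m, hmM⟩ ⟨n, hn⟩
  refine ⟨t, fun X hX => ht {t | X ∈ D.bag t} ?_ ?_ ?_⟩
  · exact (D.connected X (Q.free_subset_vars hX.1)).preconnected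
  · obtain ⟨_, b, hb, hab, hXb⟩ := mem_boundComponent_free.1 hX
    obtain ⟨Z, hZf, hZ⟩ := exists_bound_of_reflTransGen ⟨Z₀, hZ₀f, hZ₀⟩ hab
    obtain ⟨s, hs⟩ := D.covers b hb
    exact ⟨s, hs hXb, b, hab, Z, hZ, hZf, hs hZ⟩
  · obtain ⟨s, hs, hXs⟩ := hmemN X hX.1
    exact ⟨s, hXs, hs⟩

theorem TreeDecomposition.one_le_width {Q : CRPQ A V} (hne : Q.atoms.Nonempty)
    (D : Q.TreeDecomposition) : 1 ≤ D.width := by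
  obtain ⟨a, ha⟩ := hne
  obtain ⟨t, ht⟩ := D.covers a ha
  exact le_iSup_of_le t (Q.one_le_rhoStar ⟨a.src, ht (Or.inl rfl)⟩)

theorem IsAcyclic.le_fnFhtw {Q : CRPQ A V} (hQ : Q.IsAcyclic) (hne : Q.atoms.Nonempty) :
    max 1 (⨆ C ∈ Q.boundComponents, C.rhoStar C.free) ≤ Q.fnFhtw := by
  refine le_iInf₂ fun D hD => max_le (D.one_le_width hne) (iSup₂_le ?_)
  rintro C ⟨a, haQ, rfl⟩
  by_cases ha : ∃ Z, Z ∉ Q.free ∧ Z ∈ a.vars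
  · obtain ⟨t, ht⟩ := hD.exists_free_subset_bag haQ ha
    set C := Q.boundComponent a with hC
    set L := C.free_finite.toFinset with hL
    have hLC : (L : Set V) = C.free := C.free_finite.coe_toFinset
    calc C.rhoStar C.free = C.rhoStar L := by rw [hLC]
      _ ≤ L.card := C.rhoStar_le_card_self L (hLC ▸ C.free_subset_vars)
      _ ≤ Q.rhoStar (D.bag t) := by
          refine Q.card_le_rhoStar L (hLC ▸ ht) fun d hd X hX Y hY hXd hYd => ?_
          rw [← Finset.mem_coe, hLC] at hX hY
          exact hQ.eq_of_mem_boundComponent_free ha hX hY hd hXd hYd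
      _ ≤ D.width := le_iSup (fun t => Q.rhoStar (D.bag t)) t
  · -- A component without bound variables is a single atom.
    push Not at ha
    have haf : a.vars ⊆ Q.free := fun Z hZ => by_contra fun h => ha Z h hZ
    refine le_trans (rhoStar_le_one _ (a := a) ?_ ?_) (D.one_le_width hne)
    · exact mem_boundComponent_atoms.2 ⟨haQ, .refl⟩
    · intro X hX
      obtain ⟨_, b, _, hab, hXb⟩ := mem_boundComponent_free.1 hX
      rwa [eq_of_reflTransGen_of_subset_free haf hab] at hXb

/-! ### Tree decompositions from parent functions -/

/-- A bound on the width of a free-connex tree decomposition, given by a parent function on a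
finite set of nodes of any universe: for every variable, all nodes containing it but one have a
parent containing it, and the free part `N` is closed under parents. -/
theorem fnFhtw_le_of_parent (Q : CRPQ A V) {ι : Type*} [Finite ι] (par : ι → ι) (rank : ι → ℕ)
    (hrank : ∀ i, par i ≠ i → rank (par i) < rank i) (root : ι)
    (hroot : ∀ i, i ≠ root → par i ≠ i) (bag : ι → Set V) (hbag : ∀ i, bag i ⊆ Q.vars)
    (hcov : ∀ a ∈ Q.atoms, ∃ i, a.vars ⊆ bag i)
    (hconn : ∀ X ∈ Q.vars, ∃ m, X ∈ bag m ∧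
      ∀ i, X ∈ bag i → i ≠ m → par i ≠ i ∧ X ∈ bag (par i))
    (N : Set ι) (hN : root ∈ N) (hNpar : ∀ i ∈ N, par i ∈ N)
    (hNfree : ⋃ i ∈ N, bag i = Q.free) {w : ℝ≥0∞} (hw : ∀ i, Q.rhoStar (bag i) ≤ w) :
    Q.fnFhtw ≤ w := by
  -- `TreeDecomposition` requires a node type in the lowest universe.
  obtain ⟨n, ⟨e⟩⟩ := Finite.exists_equiv_fin ι
  let par' : Fin n → Fin n := fun k => e (par (e.symm k))
  have hpar' : ∀ k, par' k ≠ k ↔ par (e.symm k) ≠ e.symm k := fun k => by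
    simp only [par', ne_eq, ← Equiv.eq_symm_apply]
  have hrank' : ∀ k, par' k ≠ k → rank (e.symm (par' k)) < rank (e.symm k) := by
    intro k hk
    simpa [par'] using hrank _ ((hpar' k).1 hk)
  have hind : ∀ (S : Set (Fin n)) (m : ι), e m ∈ S →
      (∀ i, e i ∈ S → i ≠ m → par i ≠ i ∧ e (par i) ∈ S) →
      ((SimpleGraph.ofParent par').induce S).Connected := by
    intro S m hm hS
    refine SimpleGraph.ofParent_induce_connected (fun k => rank (e.symm k)) hrank' hm ?_
    intro k hk hkm
    obtain ⟨h1, h2⟩ := hS (e.symm k) (by simpa using hk)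
      (fun h => hkm (by rw [← h, Equiv.apply_symm_apply]))
    exact ⟨(hpar' k).2 h1, h2⟩
  have huniv := hind Set.univ root (Set.mem_univ _) fun i _ hi => ⟨hroot i hi, Set.mem_univ _⟩
  let D : Q.TreeDecomposition :=
    { node := Fin n
      finite_node := inferInstance
      tree := SimpleGraph.ofParent par'
      isTree := ⟨(SimpleGraph.induceUnivIso _).connected_iff.1 huniv,
        SimpleGraph.ofParent_isAcyclic (fun k => rank (e.symm k)) hrank'⟩
      bag := fun k => bag (e.symm k)
      bag_subset := fun k => hbag _
      covers := fun a ha => by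
        obtain ⟨i, hi⟩ := hcov a ha
        exact ⟨e i, by simpa using hi⟩
      connected := fun X hX => by
        obtain ⟨m, hm, h⟩ := hconn X hX
        refine hind _ m (by simpa using hm) fun i hi him => ?_
        simpa using h i (by simpa using hi) him }
  have hD : D.IsFreeConnex := by
    refine ⟨{k | e.symm k ∈ N}, ?_, ?_⟩
    · have hmem : ∀ i, e i ∈ {k | e.symm k ∈ N} ↔ i ∈ N := fun i => by simp
      exact (hind _ root ((hmem root).2 hN) fun i hi him =>
        ⟨hroot i him, (hmem _).2 (hNpar i ((hmem i).1 hi))⟩).preconnected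
    · rw [← hNfree]
      ext X
      simp only [Set.mem_iUnion, exists_prop]
      constructor
      · rintro ⟨k, hk, hX⟩
        exact ⟨e.symm k, hk, hX⟩
      · rintro ⟨i, hi, hX⟩
        exact ⟨e i, by simpa using hi, by simpa [D] using hX⟩
  exact iInf₂_le_of_le D hD (iSup_le fun k => hw _)

/-! ### Rooted query graphs -/

/-- A rooting of the query graph as a forest. Roots are their own parents, and the tree of a bound
root has no free variables. -/
structure Rooting (Q : CRPQ A V) where
  par : V → V
  depth : V → ℕ
  adj : ∀ x, par x ≠ x → Q.queryGraph.Adj x (par x)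
  depth_lt : ∀ x, par x ≠ x → depth (par x) < depth x
  eq_or_eq : ∀ u v, Q.queryGraph.Adj u v → par u = v ∨ par v = u
  root : ∀ x, par x = x → x ∉ Q.free → ∀ y, Q.queryGraph.Reachable y x → y ∉ Q.free

theorem IsAcyclic.nonempty_rooting {Q : CRPQ A V} (hQ : Q.IsAcyclic) : Nonempty Q.Rooting := by
  obtain ⟨p, d, h1, h2, h3⟩ := hQ.acyclic.exists_parent Q.free
  exact ⟨⟨p, d, fun x hx => (h1 x hx).1, fun x hx => (h1 x hx).2, h2, h3⟩⟩

namespace Rooting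

variable {Q : CRPQ A V} (R : Q.Rooting)

/-- One step upwards in the forest, to a bound parent. -/
def Step (x y : V) : Prop := R.par x = y ∧ y ≠ x ∧ y ∉ Q.free

/-- The free variables from which `u` is reached by climbing through bound variables only. For a
free variable `u` this is `{u}`. -/
def below (u : V) : Set V := {X | X ∈ Q.free ∧ Relation.ReflTransGen R.Step X u}

variable {R}

theorem step_par {x : V} (h1 : R.par x ≠ x) (h2 : R.par x ∉ Q.free) : R.Step x (R.par x) :=
  ⟨rfl, h1, h2⟩

theorem Step.par_ne {x y : V} (h : R.Step x y) : R.par x ≠ x := h.1 ▸ h.2.1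

theorem step_rightUnique : Relator.RightUnique R.Step := fun _ _ _ h h' => h.1.symm.trans h'.1

theorem depth_le_of_climb {x y : V} (h : Relation.ReflTransGen R.Step x y) :
    R.depth y ≤ R.depth x := by
  induction h with
  | refl => exact le_rfl
  | tail _ h ih =>
    have := R.depth_lt _ h.par_ne
    rw [h.1] at this
    omega

theorem reachable_of_climb {x y : V} (h : Relation.ReflTransGen R.Step x y) :
    Q.queryGraph.Reachable x y := by
  induction h with
  | refl => exact .rfl
  | tail _ h ih => exact ih.trans (h.1 ▸ (R.adj _ h.par_ne).reachable)

theorem notMem_free_of_climb {x y : V} (h : Relation.ReflTransGen R.Step x y)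
    (hx : x ∉ Q.free) : y ∉ Q.free := by
  rcases Relation.ReflTransGen.cases_tail h with rfl | ⟨_, _, h⟩
  · exact hx
  · exact h.2.2

theorem eq_of_climb_of_mem_free {x y : V} (h : Relation.ReflTransGen R.Step x y)
    (hy : y ∈ Q.free) : x = y := by
  rcases Relation.ReflTransGen.cases_tail h with rfl | ⟨_, _, h⟩
  · rfl
  · exact absurd hy h.2.2

/-- Climbing through bound variables ends, at a root or below a free parent. -/
theorem exists_climb_terminal (x : V) :
    ∃ t, Relation.ReflTransGen R.Step x t ∧ (R.par t = t ∨ R.par t ∈ Q.free) := by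
  induction hk : R.depth x using Nat.strong_induction_on generalizing x with
  | _ k ih =>
    by_cases h1 : R.par x = x
    · exact ⟨x, .refl, Or.inl h1⟩
    by_cases h2 : R.par x ∈ Q.free
    · exact ⟨x, .refl, Or.inr h2⟩
    have := R.depth_lt x h1
    obtain ⟨t, ht, h⟩ := ih _ (by omega) (R.par x) rfl
    exact ⟨t, .head (step_par h1 h2) ht, h⟩

theorem eq_of_climb_terminal {x s t : V} (hs : Relation.ReflTransGen R.Step x s)
    (ht : Relation.ReflTransGen R.Step x t) (hs' : R.par s = s ∨ R.par s ∈ Q.free)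
    (ht' : R.par t = t ∨ R.par t ∈ Q.free) : s = t := by
  have key : ∀ a b, (R.par a = a ∨ R.par a ∈ Q.free) → Relation.ReflTransGen R.Step a b →
      a = b := by
    intro a b ha hab
    rcases Relation.ReflTransGen.cases_head hab with h | ⟨c, ⟨h1, h2, h3⟩, _⟩
    · exact h
    · subst h1
      exact absurd ha (not_or.2 ⟨h2, h3⟩)
  rcases Relation.ReflTransGen.total_of_right_unique step_rightUnique hs ht with h | h
  · exact key s t hs' h
  · exact (key t s ht' h).symm

theorem par_mem_vars {x : V} (hx : x ∈ Q.vars) : R.par x ∈ Q.vars := by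
  by_cases h : R.par x = x
  · rwa [h]
  · obtain ⟨_, a, ha, _, h⟩ := queryGraph_adj.1 (R.adj x h)
    exact ⟨a, ha, h⟩

theorem mem_below_self {u : V} (hu : u ∈ Q.free) : u ∈ R.below u := ⟨hu, .refl⟩

theorem below_of_mem_free {u : V} (hu : u ∈ Q.free) : R.below u = {u} := by
  ext X
  rw [Set.mem_singleton_iff]
  constructor
  · exact fun h => eq_of_climb_of_mem_free h.2 hu
  · rintro rfl
    exact mem_below_self hu

theorem below_subset_vars (u : V) : R.below u ⊆ Q.vars := fun _ hX => Q.free_subset_vars hX.1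

/-- Climbing through bound variables stays in one bound-connected component. -/
theorem reflTransGen_sharesBound_of_climb {e : V → RPQAtom A V}
    (he : ∀ x, R.par x ≠ x → e x ∈ Q.atoms ∧ x ∈ (e x).vars ∧ R.par x ∈ (e x).vars)
    {x u : V} (hu : R.par u ≠ u) (h : Relation.ReflTransGen R.Step x u) :
    R.par x ≠ x ∧ Relation.ReflTransGen Q.SharesBound (e u) (e x) := by
  induction h using Relation.ReflTransGen.head_induction_on with
  | refl => exact ⟨hu, .refl⟩
  | @head x y hxy _ ih =>
    have hx := hxy.par_ne
    have hex := he x hx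
    have hey := he y ih.1
    rw [hxy.1] at hex
    exact ⟨hx, ih.2.tail ⟨hey.1, hex.1, y, hxy.2.2, hey.2.1, hex.2.2⟩⟩

/-- The width of the bag `{u, par u} ∪ below u`. If `u` is bound and `below u` is nonempty, then
`below u` and the first free variable above `u` are distinct free variables of one component, and
each atom of this component contains at most one free variable. -/
theorem rhoStar_bag_le (u : V) (hu : u ∈ Q.vars) :
    Q.rhoStar ({u, R.par u} ∪ R.below u) ≤
      max 1 (⨆ C ∈ Q.boundComponents, C.rhoStar C.free) := by
  obtain ⟨a₀, ha₀, hua₀⟩ := id hu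
  have hatom : ∀ x : V, ∃ a ∈ Q.atoms, R.par x ≠ x → x ∈ a.vars ∧ R.par x ∈ a.vars := by
    intro x
    by_cases h : R.par x = x
    · exact ⟨a₀, ha₀, fun h' => absurd h h'⟩
    · obtain ⟨_, a, ha, h⟩ := queryGraph_adj.1 (R.adj x h)
      exact ⟨a, ha, fun _ => h⟩
  choose e heQ he using hatom
  have he' : ∀ x, R.par x ≠ x → e x ∈ Q.atoms ∧ x ∈ (e x).vars ∧ R.par x ∈ (e x).vars :=
    fun x hx => ⟨heQ x, he x hx⟩
  have hpair : ∃ a ∈ Q.atoms, {u, R.par u} ⊆ a.vars := by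
    by_cases h : R.par u = u
    · exact ⟨a₀, ha₀, by simpa [h] using hua₀⟩
    · exact ⟨e u, heQ u, Set.insert_subset (he u h).1 (Set.singleton_subset_iff.2 (he u h).2)⟩
  obtain ⟨a, ha, hpair⟩ := hpair
  by_cases huf : u ∈ Q.free
  · refine le_max_of_le_left (Q.rhoStar_le_one ha (Set.union_subset hpair ?_))
    rw [below_of_mem_free huf]
    exact Set.singleton_subset_iff.2 (hpair (Set.mem_insert _ _))
  rcases Set.eq_empty_or_nonempty (R.below u) with hemp | ⟨X₀, hX₀⟩
  · refine le_max_of_le_left (Q.rhoStar_le_one ha ?_)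
    rwa [hemp, Set.union_empty]
  have hroot : ∀ z, Relation.ReflTransGen R.Step u z → R.par z ≠ z := fun z hz hzz =>
    R.root z hzz (notMem_free_of_climb hz huf) X₀ (reachable_of_climb (hX₀.2.trans hz)) hX₀.1
  have hu' := hroot u .refl
  obtain ⟨z, hz, hzt⟩ := exists_climb_terminal (R := R) u
  have hzf := hzt.resolve_left (hroot z hz)
  have hfin : (R.below u).Finite := Q.free_finite.subset fun X hX => hX.1
  obtain ⟨L, hL⟩ : ∃ L : Finset V, (L : Set V) = R.below u := ⟨hfin.toFinset, hfin.coe_toFinset⟩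
  have hzL : R.par z ∉ L := by
    intro h
    rw [← Finset.mem_coe, hL] at h
    have := depth_le_of_climb (h.2.trans hz)
    have := R.depth_lt z (hroot z hz)
    omega
  have hbound : ∃ Z, Z ∉ Q.free ∧ Z ∈ (e u).vars := ⟨u, huf, (he u hu').1⟩
  have hfree : (↑(Finset.cons (R.par z) L hzL) : Set V) ⊆ (Q.boundComponent (e u)).free := by
    intro X hX
    rw [Finset.coe_cons, hL] at hX
    rw [mem_boundComponent_free]
    rcases hX with rfl | hX
    · refine ⟨hzf, e z, heQ z, ?_, (he z (hroot z hz)).2⟩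
      exact Relation.ReflTransGen.mono (fun _ _ h => h.symm) _ _
        (reflTransGen_sharesBound_of_climb he' (hroot z hz) hz).2.swap
    · have h := reflTransGen_sharesBound_of_climb he' hu' hX.2
      exact ⟨hX.1, e X, heQ X, h.2, (he X h.1).1⟩
  calc Q.rhoStar ({u, R.par u} ∪ R.below u) ≤ ((L.card + 1 : ℕ) : ℝ≥0∞) := by
        refine Q.rhoStar_le_one_add_card ha L (hL ▸ below_subset_vars u) ?_
        rw [hL]
        exact Set.union_subset_union_left _ hpair
    _ = (Finset.cons (R.par z) L hzL).card := by rw [Finset.card_cons]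
    _ ≤ (Q.boundComponent (e u)).rhoStar (Q.boundComponent (e u)).free := by
        refine card_le_rhoStar _ _ hfree fun b hb X hX Y hY hXb hYb => ?_
        exact eq_of_mem_free_of_exists_bound
          (exists_bound_of_reflTransGen hbound (mem_boundComponent_atoms.1 hb).2)
          (hfree hX).1 (hfree hY).1 hXb hYb
    _ ≤ ⨆ C ∈ Q.boundComponents, C.rhoStar C.free :=
        le_iSup₂_of_le (Q.boundComponent (e u)) ⟨e u, heQ u, rfl⟩ le_rfl
    _ ≤ _ := le_max_right _ _

variable (R)

/-! ### The upper bound -/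

/-- The parent of a variable of the query, as a variable of the query. -/
def varPar (u : Q.vars) : Q.vars := ⟨R.par u, par_mem_vars u.2⟩

open Classical in
/-- The parent function of a free-connex tree decomposition. It has two nodes for each variable:
`inl u` in the free part and `inr u` in the rest; the node `none`, with an empty bag, joins the
trees of the forest. -/
noncomputable def nodePar : Option (Q.vars ⊕ Q.vars) → Option (Q.vars ⊕ Q.vars)
  | none => none
  | some (.inl u) => if R.par u = u then none else some (.inl (R.varPar u))
  | some (.inr u) =>
      if R.par u ≠ u ∧ R.par u ∉ Q.free then some (.inr (R.varPar u)) else some (.inl u)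

/-- The bags: `inr u` has `u`, its parent, and the free variables climbing to `u`; of these,
`inl u` has the free ones. -/
def nodeBag : Option (Q.vars ⊕ Q.vars) → Set V
  | none => ∅
  | some (.inl u) => ({u.1, R.par u} ∪ R.below u) ∩ Q.free
  | some (.inr u) => {u.1, R.par u} ∪ R.below u

/-- A rank that decreases towards the root `none`. -/
def nodeRank : Option (Q.vars ⊕ Q.vars) → ℕ
  | none => 0
  | some (.inl u) => R.depth u + 1
  | some (.inr u) => R.depth u + 2

variable {R}

theorem nodePar_inl_of_ne {u : Q.vars} (h : R.par u ≠ u) :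
    R.nodePar (some (.inl u)) = some (.inl (R.varPar u)) := if_neg h

theorem nodePar_inr_of_step {u : Q.vars} (h1 : R.par u ≠ u) (h2 : R.par u ∉ Q.free) :
    R.nodePar (some (.inr u)) = some (.inr (R.varPar u)) := if_pos ⟨h1, h2⟩

theorem nodePar_inr_of_terminal {u : Q.vars} (h : R.par u = u ∨ R.par u ∈ Q.free) :
    R.nodePar (some (.inr u)) = some (.inl u) :=
  if_neg fun h' => h.elim h'.1 h'.2

theorem nodeRank_nodePar_lt (i : Option (Q.vars ⊕ Q.vars)) (hi : i ≠ none) :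
    R.nodeRank (R.nodePar i) < R.nodeRank i := by
  match i with
  | none => exact absurd rfl hi
  | some (.inl u) =>
    by_cases h : R.par u = u
    · simp [nodePar, h, nodeRank]
    · have := R.depth_lt u h
      rw [nodePar_inl_of_ne h]
      simp only [nodeRank, varPar]
      omega
  | some (.inr u) =>
    by_cases h : R.par u = u ∨ R.par u ∈ Q.free
    · rw [nodePar_inr_of_terminal h]
      simp [nodeRank]
    · rw [not_or] at h
      have := R.depth_lt u h.1
      rw [nodePar_inr_of_step h.1 h.2]
      simp only [nodeRank, varPar]
      omega

theorem nodePar_ne {i : Option (Q.vars ⊕ Q.vars)} (hi : i ≠ none) : R.nodePar i ≠ i := by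
  intro h
  have := nodeRank_nodePar_lt (R := R) i hi
  rw [h] at this
  exact lt_irrefl _ this

/-- The nodes of a free variable `X` are closed under parents, except for the free node of the
last variable reached from `X` by climbing through bound variables. -/
theorem nodeBag_connected_of_mem_free {X : V} (hX : X ∈ Q.free) :
    ∃ m, X ∈ R.nodeBag m ∧ ∀ i, X ∈ R.nodeBag i → i ≠ m → X ∈ R.nodeBag (R.nodePar i) := by
  obtain ⟨t, ht, htt⟩ := exists_climb_terminal (R := R) X
  have htv : t ∈ Q.vars := by
    rcases Relation.ReflTransGen.cases_tail ht with rfl | ⟨s, _, hs⟩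
    · exact Q.free_subset_vars hX
    · obtain ⟨_, a, ha, _, h⟩ := queryGraph_adj.1 (R.adj s hs.par_ne)
      exact ⟨a, ha, hs.1 ▸ h⟩
  refine ⟨some (.inl ⟨t, htv⟩), ⟨Or.inr ⟨hX, ht⟩, hX⟩, ?_⟩
  -- A bag contains `X` through `X ∈ below u`, or because `X` is the parent of `u`.
  have hcases : ∀ u : Q.vars, X ∈ ({u.1, R.par u} ∪ R.below u : Set V) →
      X ∈ R.below u ∨ (X = R.par u ∧ R.par u ≠ u) := by
    rintro u ((rfl | h) | h)
    · exact Or.inl (mem_below_self hX)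
    · by_cases hu : R.par u = u
      · left
        rw [h, hu]
        exact mem_below_self (by rwa [← hu, ← h])
      · exact Or.inr ⟨h, hu⟩
    · exact Or.inl h
  rintro (_ | u | u) hi him
  · exact absurd hi (Set.notMem_empty X)
  · rcases hcases u hi.1 with h | ⟨h, hne⟩
    · by_cases hterm : R.par u = u ∨ R.par u ∈ Q.free
      · refine absurd ?_ him
        have : u = ⟨t, htv⟩ := Subtype.ext (eq_of_climb_terminal h.2 ht hterm htt)
        rw [this]
      · rw [not_or] at hterm
        rw [nodePar_inl_of_ne hterm.1]
        exact ⟨Or.inr ⟨hX, h.2.tail (step_par hterm.1 hterm.2)⟩, hX⟩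
    · rw [nodePar_inl_of_ne hne]
      exact ⟨Or.inl (Or.inl h), hX⟩
  · by_cases hterm : R.par u = u ∨ R.par u ∈ Q.free
    · rw [nodePar_inr_of_terminal hterm]
      exact ⟨hi, hX⟩
    · rw [not_or] at hterm
      rw [nodePar_inr_of_step hterm.1 hterm.2]
      rcases hcases u hi with h | ⟨h, _⟩
      · exact Or.inr ⟨hX, h.2.tail (step_par hterm.1 hterm.2)⟩
      · exact absurd (h ▸ hX) hterm.2

/-- The nodes of a bound variable `X` are `inr X` and the nodes `inr u` of its children `u`. -/
theorem nodeBag_connected_of_notMem_free {X : V} (hXv : X ∈ Q.vars) (hX : X ∉ Q.free) :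
    ∃ m, X ∈ R.nodeBag m ∧ ∀ i, X ∈ R.nodeBag i → i ≠ m → X ∈ R.nodeBag (R.nodePar i) := by
  refine ⟨some (.inr ⟨X, hXv⟩), Or.inl (Or.inl rfl), ?_⟩
  rintro (_ | u | u) hi him
  · exact absurd hi (Set.notMem_empty X)
  · exact absurd hi.2 hX
  · have hne : X ≠ u := fun h => him (by rw [show u = ⟨X, hXv⟩ from Subtype.ext h.symm])
    rcases hi with (h | h) | h
    · exact absurd h hne
    · have h' : X = R.par u := h
      rw [nodePar_inr_of_step (fun h'' => hne (h'.trans h'')) (by rwa [← h'])]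
      exact Or.inl (Or.inl h)
    · exact absurd h.1 hX

theorem fnFhtw_le (R : Q.Rooting) :
    Q.fnFhtw ≤ max 1 (⨆ C ∈ Q.boundComponents, C.rhoStar C.free) := by
  have := Q.vars_finite.to_subtype
  have hsub : ∀ u : Q.vars, ({u.1, R.par u} ∪ R.below u : Set V) ⊆ Q.vars := fun u =>
    Set.union_subset (Set.insert_subset u.2 (Set.singleton_subset_iff.2 (par_mem_vars u.2)))
      (below_subset_vars _)
  refine Q.fnFhtw_le_of_parent R.nodePar R.nodeRank ?_ none (fun i hi => nodePar_ne hi)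
    R.nodeBag ?_ ?_ ?_ {i | ∀ u, i ≠ some (.inr u)} (by simp) ?_ ?_ ?_
  · intro i hi
    refine nodeRank_nodePar_lt i ?_
    rintro rfl
    exact hi rfl
  · rintro (_ | u | u)
    · exact Set.empty_subset _
    · exact Set.inter_subset_left.trans (hsub u)
    · exact hsub u
  · intro a ha
    have hs : a.src ∈ Q.vars := ⟨a, ha, Or.inl rfl⟩
    have ht : a.tgt ∈ Q.vars := ⟨a, ha, Or.inr rfl⟩
    by_cases hst : a.src = a.tgt
    · refine ⟨some (.inr ⟨a.src, hs⟩), ?_⟩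
      rintro X (h | h)
      · exact Or.inl (Or.inl h)
      · exact Or.inl (Or.inl (h.trans hst.symm))
    · rcases R.eq_or_eq a.src a.tgt
        (queryGraph_adj.2 ⟨hst, a, ha, Or.inl rfl, Or.inr rfl⟩) with h | h
      · refine ⟨some (.inr ⟨a.src, hs⟩), ?_⟩
        rintro X (hX | hX)
        · exact Or.inl (Or.inl hX)
        · exact Or.inl (Or.inr (hX.trans h.symm))
      · refine ⟨some (.inr ⟨a.tgt, ht⟩), ?_⟩
        rintro X (hX | hX)
        · exact Or.inl (Or.inr (hX.trans h.symm))
        · exact Or.inl (Or.inl hX)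
  · intro X hX
    obtain ⟨m, hm, h⟩ : ∃ m, X ∈ R.nodeBag m ∧
        ∀ i, X ∈ R.nodeBag i → i ≠ m → X ∈ R.nodeBag (R.nodePar i) := by
      by_cases hf : X ∈ Q.free
      · exact nodeBag_connected_of_mem_free hf
      · exact nodeBag_connected_of_notMem_free hX hf
    refine ⟨m, hm, fun i hi him => ⟨nodePar_ne ?_, h i hi him⟩⟩
    rintro rfl
    exact hi
  · rintro (_ | u | u) hi
    · exact hi
    · by_cases h : R.par u = u
      · simp [nodePar, h]
      · simp [nodePar_inl_of_ne h]
    · exact absurd rfl (hi u)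
  · ext X
    simp only [Set.mem_iUnion, exists_prop]
    constructor
    · rintro ⟨_ | u | u, hi, h⟩
      · exact absurd h (Set.notMem_empty X)
      · exact h.2
      · exact absurd rfl (hi u)
    · intro hX
      exact ⟨some (.inl ⟨X, Q.free_subset_vars hX⟩), by simp, Or.inl (Or.inl rfl), hX⟩
  · have hmono : ∀ {S T : Set V}, S ⊆ T → Q.rhoStar S ≤ Q.rhoStar T := fun hST =>
      biInf_mono fun w hw X hX => hw X (hST hX)
    rintro (_ | u | u)
    · exact le_max_of_le_left ((Q.rhoStar_le_card ∅ (by simp) (by simp [nodeBag])).trans (by simp))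
    · exact (hmono Set.inter_subset_left).trans (rhoStar_bag_le u.1 u.2)
    · exact rhoStar_bag_le u.1 u.2

end Rooting

end CRPQ

theorem mainTheorem3 {A V : Type*} (Q : CRPQ A V) (hne : Q.atoms.Nonempty) (hQ : Q.IsAcyclic) :
    Q.fnFhtw = max 1 (⨆ C ∈ Q.boundComponents, C.rhoStar C.free) := by
  obtain ⟨R⟩ := hQ.nonempty_rooting
  exact le_antisymm R.fnFhtw_le (hQ.le_fnFhtw hne)
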